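/- Let $a$ and $x$ be complex numbers with $a\neq 0$ and $|x|<1$. Write \[ (A;q)_n=\prod_{k=0}^{n-1}(1-Aq^k),\qquad f(b,c)=\sum_{j=-\infty}^{\infty} b^{j(j+1)/2}c^{j(j-1)/2},\qquad f(-q)=f(-q,-q^2) \] for the rising $q$-factorial, Ramanujan's theta function and its one-variable abbreviation (with the convention $0^0=1$). Then the series defining $f(a,x^6/a)$ and $f(-x^2)$ converge absolutely, $f(-x^2)\neq 0$, and \[ \sum_{n=0}^{\infty}\frac{x^{2n(n+1)}\,(-a;x^2)_{n+1}\,(-x^2/a;x^2)_n}{(x^2;x^2)_{2n+1}} =\frac{f(a,x^6/a)}{f(-x^2)}, \] where the series on the left converges absolutely. -/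

import Mathlib

/-- The rising `q`-factorial `(A; q)_n = (1 - A) (1 - A q) ⋯ (1 - A q ^ (n - 1))`. -/
noncomputable def qFactorial (A q : ℂ) (n : ℕ) : ℂ :=
  ∏ k ∈ Finset.range n, (1 - A * q ^ k)

/-- The general term `a ^ (j (j + 1) / 2) * b ^ (j (j - 1) / 2)` of Ramanujan's theta series.
For every integer `j` both exponents are non-negative integers (the divisions are exact). -/
noncomputable def ramanujanThetaTerm (a b : ℂ) (j : ℤ) : ℂ :=
  a ^ (j * (j + 1) / 2) * b ^ (j * (j - 1) / 2)

/-- Ramanujan's theta function `f(a, b) = ∑_{j ∈ ℤ} a ^ (j (j + 1) / 2) b ^ (j (j - 1) / 2)`. -/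
noncomputable def ramanujanTheta (a b : ℂ) : ℂ :=
  ∑' j : ℤ, ramanujanThetaTerm a b j

/-- Ramanujan's one-variable abbreviation `f(-q) = f(-q, -q ^ 2)`, as a function of the
argument `z = -q`, so that `f(z) = f(z, -z ^ 2)`. -/
noncomputable def ramanujanF (z : ℂ) : ℂ :=
  ramanujanTheta z (-z ^ 2)

open Filter Topology

/-! Put q = x². By the finite Jacobi triple product (`hasSum_finite_jacobi`), the n-th quotient of
q-factorials is a sum over integers j of a^j q^{j(j-1)/2} / ((q;q)_{n+j} (q;q)_{n+1-j}). Weight by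
q^{n(n+1)}, sum over n and interchange the sums. For fixed j the sum over n is a Durfee rectangle
sum, equal to q^{j(j-1)} / (q;q)_∞ (`hasSum_durfee_int`). The exponents add up to 3j(j-1)/2, which
leaves the theta series of f(a, q³/a) over (q;q)_∞. The pentagonal number theorem
(`tsum_pentagonal`) identifies (q;q)_∞ with f(-q); its nonvanishing is that of a convergent product.
-/

/-- The limit `(q; q)_∞` of the rising `q`-factorials `(q; q)_n`. -/
noncomputable def qFactorialInf (q : ℂ) : ℂ := ∏' k : ℕ, (1 - q * q ^ k)

/-- The reciprocal `1 / (q; q)_k`, extended by zero to negative `k`. -/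
noncomputable def invQFactorial (q : ℂ) (k : ℤ) : ℂ :=
  if 0 ≤ k then (qFactorial q q k.toNat)⁻¹ else 0

/-- The triangular number `j (j - 1) / 2`. -/
def intTriangle (j : ℤ) : ℤ := j * (j - 1) / 2

theorem two_mul_intTriangle (j : ℤ) : 2 * intTriangle j = j * (j - 1) :=
  Int.two_mul_ediv_two_of_even (by rcases Int.even_or_odd j with h | h <;> grind)

theorem qFactorial_succ (A q : ℂ) (n : ℕ) :
    qFactorial A q (n + 1) = qFactorial A q n * (1 - A * q ^ n) :=
  Finset.prod_range_succ _ _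

theorem qFactorial_succ' (A q : ℂ) (n : ℕ) :
    qFactorial A q (n + 1) = (1 - A) * qFactorial (A * q) q n := by
  simp only [qFactorial, Finset.prod_range_succ', pow_succ', pow_zero, mul_one, mul_assoc]
  ring

/-! ### Convergence and uniform bounds -/

section convergence

variable {q : ℂ}

theorem one_sub_mul_pow_ne_zero (hq : ‖q‖ < 1) (k : ℕ) : 1 - q * q ^ k ≠ 0 := by
  intro h
  have h1 : ‖q ^ (k + 1)‖ = 1 := by
    rw [pow_succ', ← sub_eq_zero.mp h, norm_one]
  rw [norm_pow] at h1
  exact (pow_lt_one₀ (norm_nonneg _) hq (Nat.succ_ne_zero k)).ne h1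

theorem qFactorial_self_ne_zero (hq : ‖q‖ < 1) (n : ℕ) : qFactorial q q n ≠ 0 :=
  Finset.prod_ne_zero_iff.mpr fun k _ => one_sub_mul_pow_ne_zero hq k

theorem summable_norm_neg_mul_pow (hq : ‖q‖ < 1) : Summable fun k : ℕ => ‖-(q * q ^ k)‖ := by
  simpa using (summable_geometric_of_lt_one (norm_nonneg q) hq).mul_left ‖q‖

theorem qFactorialInf_ne_zero (hq : ‖q‖ < 1) : qFactorialInf q ≠ 0 := by
  have := tprod_one_add_ne_zero_of_summable (f := fun k : ℕ => -(q * q ^ k))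
    (fun k => by simpa [sub_eq_add_neg] using one_sub_mul_pow_ne_zero hq k)
    (summable_norm_neg_mul_pow hq)
  simpa [qFactorialInf, sub_eq_add_neg] using this

theorem tendsto_qFactorial_self (hq : ‖q‖ < 1) :
    Tendsto (qFactorial q q) atTop (𝓝 (qFactorialInf q)) := by
  have h : Multipliable fun k : ℕ => 1 - q * q ^ k := by
    simpa [sub_eq_add_neg] using multipliable_one_add_of_summable (summable_norm_neg_mul_pow hq)
  exact h.tendsto_prod_tprod_nat

theorem invQFactorial_natCast (n : ℕ) : invQFactorial q n = (qFactorial q q n)⁻¹ := by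
  simp [invQFactorial]

theorem invQFactorial_of_neg {k : ℤ} (hk : k < 0) : invQFactorial q k = 0 := by
  simp [invQFactorial, hk]

theorem invQFactorial_zero : invQFactorial q 0 = 1 := by
  simp [invQFactorial, qFactorial]

/-- Extension by zero makes this hold at k ≤ 0 too, so later recurrences need no boundary cases. -/
theorem invQFactorial_sub_one (hq : ‖q‖ < 1) (k : ℤ) :
    invQFactorial q (k - 1) = (1 - q ^ k) * invQFactorial q k := by
  rcases lt_trichotomy k 0 with h | rfl | h
  · rw [invQFactorial_of_neg h, invQFactorial_of_neg (by lia), mul_zero]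
  · rw [invQFactorial_of_neg (by lia)]; simp
  · obtain ⟨n, rfl⟩ : ∃ n : ℕ, k = (n + 1 : ℕ) := ⟨(k - 1).toNat, by lia⟩
    rw [show ((n + 1 : ℕ) : ℤ) - 1 = n by push_cast; ring, invQFactorial_natCast,
      invQFactorial_natCast, qFactorial_succ, zpow_natCast, pow_succ']
    field_simp [qFactorial_self_ne_zero hq n, one_sub_mul_pow_ne_zero hq n]

theorem tendsto_invQFactorial (hq : ‖q‖ < 1) :
    Tendsto (invQFactorial q) atTop (𝓝 (qFactorialInf q)⁻¹) := by
  have h := ((tendsto_qFactorial_self hq).inv₀ (qFactorialInf_ne_zero hq)).comp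
    (tendsto_atTop_atTop.mpr fun b => ⟨(b : ℤ), fun a ha => by lia⟩ :
      Tendsto Int.toNat atTop atTop)
  refine h.congr' ?_
  filter_upwards [eventually_ge_atTop 0] with k hk
  simp [invQFactorial, hk]

/-- This uniform bound supplies the dominating series in every limit and interchange below. -/
theorem exists_norm_invQFactorial_le (hq : ‖q‖ < 1) : ∃ C, 0 ≤ C ∧ ∀ k, ‖invQFactorial q k‖ ≤ C := by
  obtain ⟨C, hC⟩ := ((tendsto_qFactorial_self hq).inv₀
    (qFactorialInf_ne_zero hq)).norm.bddAbove_range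
  have hC' (n : ℕ) : ‖(qFactorial q q n)⁻¹‖ ≤ C := hC ⟨n, rfl⟩
  have h0 : 0 ≤ C := (norm_nonneg _).trans (hC' 0)
  refine ⟨C, h0, fun k => ?_⟩
  unfold invQFactorial
  split_ifs
  · exact hC' _
  · simpa using h0

/-- The terms of a two-sided theta series are absolutely summable. -/
theorem summable_norm_zpow_mul_zpow_intTriangle (hq0 : q ≠ 0) (hq : ‖q‖ < 1) {a : ℂ}
    (ha : a ≠ 0) : Summable fun j : ℤ => ‖a ^ j * q ^ intTriangle j‖ := by
  have hlim (c : ℂ) : Tendsto (fun n : ℕ => ‖c * q ^ n‖) atTop (𝓝 0) := by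
    simpa using ((tendsto_pow_atTop_nhds_zero_of_norm_lt_one hq).const_mul c).norm
  have key (u : ℕ → ℂ) (c : ℂ) (hu : ∀ n, u n ≠ 0) (h : ∀ n, u (n + 1) = u n * (c * q ^ n)) :
      Summable fun n => ‖u n‖ := by
    -- Consecutive terms have ratio c q^n, which tends to 0.
    refine summable_of_ratio_test_tendsto_lt_one zero_lt_one
      (Eventually.of_forall fun n => norm_ne_zero_iff.mpr (hu n)) ((hlim c).congr fun n => ?_)
    rw [h, norm_norm, norm_norm, norm_mul (u n)]
    field_simp [norm_ne_zero_iff.mpr (hu n)]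
  have hne (j : ℤ) : a ^ j * q ^ intTriangle j ≠ 0 :=
    mul_ne_zero (zpow_ne_zero _ ha) (zpow_ne_zero _ hq0)
  refine Summable.of_nat_of_neg ?_ ?_
  · refine key (fun n : ℕ => a ^ (n : ℤ) * q ^ intTriangle n) a (fun n => hne _) fun n => ?_
    have : intTriangle ((n + 1 : ℕ) : ℤ) = intTriangle n + n := by
      have h1 := two_mul_intTriangle (n + 1 : ℕ)
      have h2 := two_mul_intTriangle n
      push_cast at *; linarith
    simp only [this, zpow_add₀ hq0, zpow_natCast, pow_succ]
    ring
  · refine key (fun n : ℕ => a ^ (-(n : ℤ)) * q ^ intTriangle (-(n : ℤ))) (a⁻¹ * q)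
      (fun n => hne _) fun n => ?_
    have : intTriangle (-((n + 1 : ℕ) : ℤ)) = intTriangle (-(n : ℤ)) + (n + 1 : ℕ) := by
      have h1 := two_mul_intTriangle (-((n + 1 : ℕ) : ℤ))
      have h2 := two_mul_intTriangle (-(n : ℤ))
      push_cast at *; linarith
    simp only [this, zpow_add₀ hq0, zpow_natCast, zpow_neg, pow_succ, mul_inv]
    ring

end convergence

/-! ### Finite and infinite triple products, pentagonal numbers -/

section qBinomial

variable {q : ℂ}

/-- The **`q`-binomial theorem**, as a sum over all integers. -/
theorem hasSum_qBinomial (hq0 : q ≠ 0) (hq : ‖q‖ < 1) {z : ℂ} (hz : z ≠ 0) (N : ℕ) :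
    HasSum (fun k : ℤ => invQFactorial q k * invQFactorial q (N - k) * q ^ intTriangle k * z ^ k)
      (qFactorial (-z) q N / qFactorial q q N) := by
  induction N with
  | zero =>
    have h := hasSum_single (f := fun k : ℤ =>
      invQFactorial q k * invQFactorial q ((0 : ℕ) - k) * q ^ intTriangle k * z ^ k) 0 ?_
    · simpa [invQFactorial_zero, qFactorial, intTriangle] using h
    · intro k hk
      rcases lt_or_gt_of_ne hk with h | h
      · simp [invQFactorial_of_neg h]
      · simp [invQFactorial_of_neg (show -k < 0 by lia)]
  | succ N ih =>
    have hne := one_sub_mul_pow_ne_zero hq N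
    -- The new factor 1 + z q^N adds to the old sum a copy shifted by k ↦ k - 1; termwise this is
    -- the q-Pascal rule.
    have ih' := ((Equiv.subRight (1 : ℤ)).hasSum_iff.mpr ih).mul_left (z * q ^ N)
    have h := (ih.add ih').mul_left (1 - q * q ^ N)⁻¹
    convert! h using 1
    · funext k
      have e1 : invQFactorial q (N - k) = (1 - q ^ ((N : ℤ) + 1 - k)) *
          invQFactorial q ((N : ℤ) + 1 - k) := by
        rw [← invQFactorial_sub_one hq]; congr 1; ring
      have e2 : intTriangle (k - 1) = intTriangle k + (1 - k) := by
        have h1 := two_mul_intTriangle k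
        have h2 := two_mul_intTriangle (k - 1)
        linarith
      have e3 : (N : ℤ) - (k - 1) = N + 1 - k := by ring
      have hqk := zpow_ne_zero k hq0
      simp only [Function.comp_apply, Equiv.subRight_apply, e1, e2, e3,
        invQFactorial_sub_one hq k, Nat.cast_add, Nat.cast_one]
      simp only [zpow_add₀ hq0, zpow_sub₀ hq0, zpow_sub₀ hz, zpow_one, zpow_natCast]
      field_simp
      ring
    · rw [qFactorial_succ, qFactorial_succ]
      field_simp [qFactorial_self_ne_zero hq N]
      ring

/-- The left side is the product of 1 + a q^i over -n ≤ i ≤ n; pull a q^i out of each factor with i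
< 0. -/
theorem qFactorial_neg_mul_zpow_neg (hq0 : q ≠ 0) {a : ℂ} (ha : a ≠ 0) (n : ℕ) :
    qFactorial (-(a * q ^ (-(n : ℤ)))) q (2 * n + 1) =
      a ^ n * (q ^ intTriangle (-n))⁻¹ * (qFactorial (-a) q (n + 1) * qFactorial (-q / a) q n) := by
  induction n with
  | zero => simp [qFactorial, intTriangle]
  | succ n ih =>
    have e : intTriangle (-((n + 1 : ℕ) : ℤ)) = intTriangle (-(n : ℤ)) + (n + 1 : ℕ) := by
      have h1 := two_mul_intTriangle (-((n + 1 : ℕ) : ℤ))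
      have h2 := two_mul_intTriangle (-(n : ℤ))
      push_cast at *; linarith
    have e2 : -(a * q ^ (-((n + 1 : ℕ) : ℤ))) * q = -(a * q ^ (-(n : ℤ))) := by
      simp only [zpow_neg, zpow_natCast, pow_succ]
      field_simp
    rw [show 2 * (n + 1) + 1 = (2 * n + 1) + 1 + 1 by ring, qFactorial_succ', e2, qFactorial_succ,
      ih, e, qFactorial_succ (-a) q (n + 1), qFactorial_succ (-q / a), zpow_add₀ hq0]
    simp only [zpow_neg, zpow_natCast]
    have ht := zpow_ne_zero (intTriangle (-(n : ℤ))) hq0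
    field_simp
    ring

/-- The finite form of the Jacobi triple product identity. -/
theorem hasSum_finite_jacobi (hq0 : q ≠ 0) (hq : ‖q‖ < 1) {a : ℂ} (ha : a ≠ 0) (n : ℕ) :
    HasSum (fun j : ℤ => invQFactorial q (n + j) * invQFactorial q (n + 1 - j) *
        (a ^ j * q ^ intTriangle j))
      (qFactorial (-a) q (n + 1) * qFactorial (-q / a) q n / qFactorial q q (2 * n + 1)) := by
  have hz : a * q ^ (-(n : ℤ)) ≠ 0 := mul_ne_zero ha (zpow_ne_zero _ hq0)
  have ht := zpow_ne_zero (intTriangle (-(n : ℤ))) hq0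
  have h := ((Equiv.addLeft (n : ℤ)).hasSum_iff.mpr
    (hasSum_qBinomial hq0 hq hz (2 * n + 1))).mul_left ((a ^ n)⁻¹ * q ^ intTriangle (-(n : ℤ)))
  rw [qFactorial_neg_mul_zpow_neg hq0 ha] at h
  convert! h using 1
  · funext j
    have e1 : ((2 * n + 1 : ℕ) : ℤ) - (n + j) = n + 1 - j := by push_cast; ring
    have e2 : intTriangle j = intTriangle (-(n : ℤ)) + intTriangle (n + j) + -(n : ℤ) * (n + j) := by
      have h1 := two_mul_intTriangle j
      have h2 := two_mul_intTriangle (-(n : ℤ))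
      have h3 := two_mul_intTriangle (n + j)
      linarith
    simp only [Function.comp_apply, Equiv.coe_addLeft, e1, mul_zpow, ← zpow_mul]
    rw [e2, zpow_add₀ hq0, zpow_add₀ hq0, zpow_add₀ ha, zpow_natCast]
    field_simp
  · field_simp

theorem tendsto_finite_jacobi (hq0 : q ≠ 0) (hq : ‖q‖ < 1) {a : ℂ} (ha : a ≠ 0) :
    Tendsto (fun n : ℕ => qFactorial (-a) q (n + 1) * qFactorial (-q / a) q n /
      qFactorial q q (2 * n + 1)) atTop
      (𝓝 (∑' j : ℤ, (qFactorialInf q)⁻¹ * (qFactorialInf q)⁻¹ * (a ^ j * q ^ intTriangle j))) := by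
  obtain ⟨C, hC0, hC⟩ := exists_norm_invQFactorial_le hq
  simp_rw [← (hasSum_finite_jacobi hq0 hq ha _).tsum_eq]
  refine tendsto_tsum_of_dominated_convergence
    (bound := fun j => C * C * ‖a ^ j * q ^ intTriangle j‖)
    ((summable_norm_zpow_mul_zpow_intTriangle hq0 hq ha).mul_left _) (fun j => ?_)
    (Eventually.of_forall fun n j => ?_)
  · refine Tendsto.mul_const _ (Tendsto.mul ?_ ?_)
    · exact (tendsto_invQFactorial hq).comp
        (tendsto_atTop_add_const_right _ _ tendsto_natCast_atTop_atTop)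
    · refine ((tendsto_invQFactorial hq).comp
        (tendsto_atTop_add_const_right _ (1 - j) tendsto_natCast_atTop_atTop)).congr fun n => ?_
      simp [add_sub_assoc]
  · rw [norm_mul, norm_mul (invQFactorial _ _)]
    gcongr <;> exact hC _

/-- Sort the factors 1 - q^i by i modulo 3. -/
theorem qFactorial_trisection (q : ℂ) (n : ℕ) :
    qFactorial q (q ^ 3) (n + 1) * qFactorial (q ^ 2) (q ^ 3) n * qFactorial (q ^ 3) (q ^ 3) n =
      qFactorial q q (3 * n + 1) := by
  induction n with
  | zero => simp [qFactorial]
  | succ n ih =>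
    rw [show 3 * (n + 1) + 1 = 3 * n + 1 + 1 + 1 + 1 by ring, qFactorial_succ q q, qFactorial_succ q q,
      qFactorial_succ q q, ← ih, qFactorial_succ q _ (n + 1), qFactorial_succ (q ^ 2),
      qFactorial_succ (q ^ 3)]
    ring

/-- Euler's pentagonal number theorem. -/
theorem tsum_pentagonal (hq0 : q ≠ 0) (hq : ‖q‖ < 1) :
    ∑' j : ℤ, (-q) ^ j * (q ^ 3) ^ intTriangle j = qFactorialInf q := by
  have hQ : ‖q ^ 3‖ < 1 := by
    rw [norm_pow]; exact pow_lt_one₀ (norm_nonneg _) hq (by norm_num)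
  have hP := qFactorialInf_ne_zero hQ
  have h1 := tendsto_finite_jacobi (pow_ne_zero 3 hq0) hQ (neg_ne_zero.mpr hq0)
  have hP1 := tendsto_qFactorial_self hQ
  have hP2 := hP1.comp (tendsto_atTop_mono (fun n : ℕ => (by lia : n ≤ 2 * n + 1)) tendsto_id)
  have hP3 := (tendsto_qFactorial_self hq).comp
    (tendsto_atTop_mono (fun n : ℕ => (by lia : n ≤ 3 * n + 1)) tendsto_id)
  -- With base q³ and a = -q, these two factors turn the triple product quotient into (q;q)_{3n+1},
  -- and their limits cancel the two inverse infinite products.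
  have h2 := (h1.mul hP2).mul hP1
  rw [tsum_mul_left] at h2
  have h3 := tendsto_nhds_unique (h2.congr fun n => ?_) hP3
  · rw [← h3]; field_simp
  · have e : -q ^ 3 / -q = q ^ 2 := by field_simp
    simp only [Function.comp_apply, neg_neg, e, ← qFactorial_trisection]
    field_simp [qFactorial_self_ne_zero hQ (2 * n + 1)]

end qBinomial

/-! ### Durfee rectangles -/

section durfee

variable {q : ℂ}

/-- The summand of the Durfee rectangle identity. -/
noncomputable def durfeeTerm (q : ℂ) (k m : ℕ) : ℂ :=
  q ^ (m * (m + k)) * (invQFactorial q m * invQFactorial q (m + k))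

theorem exists_norm_durfeeTerm_le (hq : ‖q‖ < 1) :
    ∃ C, 0 ≤ C ∧ ∀ k m, ‖durfeeTerm q k m‖ ≤ ‖q‖ ^ m * C := by
  obtain ⟨C, hC0, hC⟩ := exists_norm_invQFactorial_le hq
  refine ⟨C * C, by positivity, fun k m => ?_⟩
  rw [durfeeTerm, norm_mul, norm_mul, norm_pow]
  refine mul_le_mul (pow_le_pow_of_le_one (norm_nonneg _) hq.le ?_)
    (mul_le_mul (hC _) (hC _) (norm_nonneg _) hC0) (by positivity) (by positivity)
  nlinarith [Nat.zero_le (m * k), Nat.le_mul_self m]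

theorem summable_durfeeTerm (hq : ‖q‖ < 1) (k : ℕ) : Summable (durfeeTerm q k) := by
  obtain ⟨C, -, hC⟩ := exists_norm_durfeeTerm_le hq
  exact .of_norm_bounded ((summable_geometric_of_lt_one (norm_nonneg q) hq).mul_right C) (hC k)

/-- As k grows, only the m = 0 term survives. -/
theorem tendsto_tsum_durfeeTerm (hq : ‖q‖ < 1) :
    Tendsto (fun k => ∑' m, durfeeTerm q k m) atTop (𝓝 (qFactorialInf q)⁻¹) := by
  obtain ⟨C, -, hC⟩ := exists_norm_durfeeTerm_le hq
  have h := tendsto_tsum_of_dominated_convergence (𝓕 := atTop) (f := durfeeTerm q)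
    (g := fun m => if m = 0 then (qFactorialInf q)⁻¹ else 0)
    ((summable_geometric_of_lt_one (norm_nonneg q) hq).mul_right C) (fun m => ?_)
    (Eventually.of_forall hC)
  · simpa using h
  · have h1 : Tendsto (fun k : ℕ => invQFactorial q (m + k)) atTop (𝓝 (qFactorialInf q)⁻¹) :=
      (tendsto_invQFactorial hq).comp
        (tendsto_atTop_add_const_left _ _ tendsto_natCast_atTop_atTop)
    by_cases hm : m = 0
    · subst hm
      simpa [durfeeTerm, invQFactorial_zero] using h1
    · have h2 : Tendsto (fun k : ℕ => q ^ (m * (m + k))) atTop (𝓝 0) := by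
        refine (tendsto_pow_atTop_nhds_zero_of_norm_lt_one hq).comp
          (tendsto_atTop_mono (fun k => ?_) tendsto_id)
        exact (Nat.le_add_left k m).trans (Nat.le_mul_of_pos_left _ (Nat.pos_of_ne_zero hm))
      simpa [durfeeTerm, hm] using h2.mul (h1.const_mul (invQFactorial q m))

/-- The auxiliary series `u` is summed in two ways: directly, and, since its m = 0 term vanishes,
after an index shift that turns it into the series for k + 2. -/
theorem tsum_durfeeTerm_sub (hq : ‖q‖ < 1) (k : ℕ) :
    ∑' m, durfeeTerm q k m - ∑' m, durfeeTerm q (k + 1) m =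
      -q ^ (k + 1) * (∑' m, durfeeTerm q (k + 1) m - ∑' m, durfeeTerm q (k + 2) m) := by
  have h0 := summable_durfeeTerm hq k
  have h1 := summable_durfeeTerm hq (k + 1)
  have h2 := summable_durfeeTerm hq (k + 2)
  set u : ℕ → ℂ := fun m =>
    durfeeTerm q k m - durfeeTerm q (k + 1) m + q ^ (k + 1) * durfeeTerm q (k + 1) m with hu
  have hu_eq (m : ℕ) : u m =
      q ^ (m * (m + k)) * (invQFactorial q (m - 1) * invQFactorial q (m + k + 1)) := by
    have e : invQFactorial q (m + k) =
        (1 - q ^ ((m : ℤ) + k + 1)) * invQFactorial q (m + k + 1) := by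
      rw [← invQFactorial_sub_one hq]; congr 1; ring
    have e' : (q ^ ((m : ℤ) + k + 1)) = q ^ (m + k + 1) := by
      rw [← zpow_natCast]; push_cast; rfl
    simp only [hu, durfeeTerm, e, e', invQFactorial_sub_one hq m, zpow_natCast]
    push_cast
    rw [← add_assoc]
    ring_nf
  have hu_succ (m : ℕ) : u (m + 1) = q ^ (k + 1) * durfeeTerm q (k + 2) m := by
    rw [hu_eq, durfeeTerm]
    push_cast
    rw [show (m : ℤ) + 1 - 1 = m by ring, show (m : ℤ) + 1 + k + 1 = m + (k + 2) by ring]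
    ring
  have hs : Summable u := (h0.sub h1).add (h1.mul_left _)
  have hA : ∑' m, u m = ∑' m, durfeeTerm q k m - ∑' m, durfeeTerm q (k + 1) m +
      q ^ (k + 1) * ∑' m, durfeeTerm q (k + 1) m := by
    rw [hu, (h0.sub h1).tsum_add (h1.mul_left _), h0.tsum_sub h1, tsum_mul_left]
  have hB : ∑' m, u m = q ^ (k + 1) * ∑' m, durfeeTerm q (k + 2) m := by
    rw [hs.tsum_eq_zero_add, hu_eq 0, invQFactorial_of_neg (by simp)]
    simp [hu_succ, tsum_mul_left]
  linear_combination hB - hA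

/-- Iterating the recurrence bounds each difference by arbitrarily late ones, which tend to 0. -/
theorem tsum_durfeeTerm_eq_succ (hq : ‖q‖ < 1) (k : ℕ) :
    ∑' m, durfeeTerm q k m = ∑' m, durfeeTerm q (k + 1) m := by
  set D : ℕ → ℂ := fun k => ∑' m, durfeeTerm q k m - ∑' m, durfeeTerm q (k + 1) m with hD
  have hlim : Tendsto (fun N => ‖D (k + N)‖) atTop (𝓝 0) := by
    have h := tendsto_tsum_durfeeTerm hq
    have h' := (h.sub (h.comp (tendsto_add_atTop_nat 1))).norm
    rw [sub_self, norm_zero] at h'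
    simpa only [add_comm k] using! h'.comp (tendsto_add_atTop_nat k)
  have hstep (N : ℕ) : ‖D k‖ ≤ ‖D (k + N)‖ := by
    induction N with
    | zero => rfl
    | succ N ih =>
      refine ih.trans ?_
      simp only [hD]
      rw [tsum_durfeeTerm_sub hq, norm_mul, norm_neg, norm_pow]
      exact mul_le_of_le_one_left (norm_nonneg _) (pow_le_one₀ (norm_nonneg _) hq.le)
  have h0 : ‖D k‖ ≤ 0 := ge_of_tendsto' hlim hstep
  exact sub_eq_zero.mp (norm_le_zero_iff.mp h0)

/-- The **Durfee rectangle identity**. -/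
theorem hasSum_durfeeTerm (hq : ‖q‖ < 1) (k : ℕ) :
    HasSum (durfeeTerm q k) (qFactorialInf q)⁻¹ := by
  have hconst (N : ℕ) : ∑' m, durfeeTerm q (N + k) m = ∑' m, durfeeTerm q k m := by
    induction N with
    | zero => rw [zero_add]
    | succ N ih => rw [← ih, Nat.add_right_comm, ← tsum_durfeeTerm_eq_succ hq]
  have h := (tendsto_tsum_durfeeTerm hq).comp (tendsto_add_atTop_nat k)
  simp only [Function.comp_def, hconst] at h
  rw [← tendsto_nhds_unique tendsto_const_nhds h]
  exact (summable_durfeeTerm hq k).hasSum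

/-- Terms with n < s vanish; for n = m + s, n(n+1) = m(m+2s+1) + s(s+1). -/
theorem hasSum_durfee_shift (hq : ‖q‖ < 1) (s : ℕ) :
    HasSum (fun n : ℕ => q ^ (n * (n + 1)) *
      (invQFactorial q (n - s) * invQFactorial q (n + 1 + s)))
      (q ^ (s * (s + 1)) * (qFactorialInf q)⁻¹) := by
  refine ((add_left_injective s).hasSum_iff fun n hn => ?_).mp ?_
  · have : n < s := by
      by_contra! h
      exact hn ⟨n - s, Nat.sub_add_cancel h⟩
    rw [invQFactorial_of_neg (by lia)]
    simp
  · convert! (hasSum_durfeeTerm hq (2 * s + 1)).mul_left (q ^ (s * (s + 1))) using 1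
    funext m
    simp only [Function.comp_apply, durfeeTerm]
    push_cast
    rw [show (m : ℤ) + s - s = m by ring, show (m : ℤ) + s + 1 + s = m + (2 * s + 1) by ring]
    ring

/-- Both sides are invariant under j ↦ 1 - j, so j = -s and j = s + 1 reduce to the same sum. -/
theorem hasSum_durfee_int (hq : ‖q‖ < 1) (j : ℤ) :
    HasSum (fun n : ℕ => q ^ (n * (n + 1)) *
      (invQFactorial q (n + j) * invQFactorial q (n + 1 - j)))
      (q ^ (2 * intTriangle j) * (qFactorialInf q)⁻¹) := by
  rcases le_or_gt j 0 with hj | hj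
  · obtain ⟨s, rfl⟩ : ∃ s : ℕ, j = -s := ⟨(-j).toNat, by lia⟩
    convert! hasSum_durfee_shift hq s using 1
    · simp only [sub_neg_eq_add, ← sub_eq_add_neg]
    · rw [two_mul_intTriangle, ← zpow_natCast]
      congr 2
      push_cast; ring
  · obtain ⟨s, rfl⟩ : ∃ s : ℕ, j = s + 1 := ⟨(j - 1).toNat, by lia⟩
    convert! hasSum_durfee_shift hq s using 1
    · funext n
      rw [mul_comm (invQFactorial q _), show (n : ℤ) + 1 - (s + 1) = n - s by ring,
        show (n : ℤ) + (s + 1) = n + 1 + s by ring]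
    · rw [two_mul_intTriangle, ← zpow_natCast]
      congr 2
      push_cast; ring

end durfee

/-! ### Interchange of summation and conclusion -/

theorem hasSum_qSeries {q : ℂ} (hq0 : q ≠ 0) (hq : ‖q‖ < 1) {a : ℂ} (ha : a ≠ 0) :
    HasSum (fun n : ℕ => q ^ (n * (n + 1)) * (qFactorial (-a) q (n + 1) *
        qFactorial (-q / a) q n / qFactorial q q (2 * n + 1)))
      ((∑' j : ℤ, a ^ j * (q ^ 3) ^ intTriangle j) * (qFactorialInf q)⁻¹) := by
  obtain ⟨C, hC0, hC⟩ := exists_norm_invQFactorial_le hq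
  set G : ℕ × ℤ → ℂ := fun p => q ^ (p.1 * (p.1 + 1)) *
    (invQFactorial q (p.1 + p.2) * invQFactorial q (p.1 + 1 - p.2) *
      (a ^ p.2 * q ^ intTriangle p.2)) with hG
  -- Domination by a geometric series in n times a theta series in j justifies the interchange.
  have hsum : Summable G := by
    refine .of_norm_bounded ((summable_geometric_of_lt_one (norm_nonneg q) hq).mul_of_nonneg
      ((summable_norm_zpow_mul_zpow_intTriangle hq0 hq ha).mul_left (C * C))
      (fun n => by positivity) (fun j => by positivity)) fun p => ?_
    rw [hG, norm_mul, norm_mul, norm_mul (invQFactorial _ _), norm_pow]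
    have hpow : ‖q‖ ^ (p.1 * (p.1 + 1)) ≤ ‖q‖ ^ p.1 :=
      pow_le_pow_of_le_one (norm_nonneg _) hq.le (Nat.le_mul_of_pos_right _ (Nat.succ_pos _))
    gcongr <;> exact hC _
  have hrow := hsum.hasSum.prod_fiberwise fun n =>
    (hasSum_finite_jacobi hq0 hq ha n).mul_left (q ^ (n * (n + 1)))
  have hcol := ((Equiv.prodComm ℤ ℕ).hasSum_iff.mpr hsum.hasSum).prod_fiberwise
    (g := fun j : ℤ => a ^ j * (q ^ 3) ^ intTriangle j * (qFactorialInf q)⁻¹) fun j => by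
      convert! (hasSum_durfee_int hq j).mul_right (a ^ j * q ^ intTriangle j) using 1
      · funext n
        simp only [hG, Function.comp_apply, Equiv.prodComm_apply, Prod.swap]
        ring
      · rw [← zpow_natCast q 3, ← zpow_mul,
          show ((3 : ℕ) : ℤ) * intTriangle j = 2 * intTriangle j + intTriangle j by push_cast; ring,
          zpow_add₀ hq0]
        ring
  rwa [← hcol.tsum_eq, tsum_mul_right] at hrow

theorem ramanujanThetaTerm_eq {a b Q : ℂ} (ha : a ≠ 0) (hb : b = Q / a) (j : ℤ) :
    ramanujanThetaTerm a b j = a ^ j * Q ^ intTriangle j := by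
  have e : j * (j + 1) / 2 = j + intTriangle j := by
    have h := two_mul_intTriangle j
    rw [show j * (j + 1) = (j + intTriangle j) * 2 by linarith]
    exact Int.mul_ediv_cancel _ (by norm_num)
  rw [ramanujanThetaTerm, e, hb, ← intTriangle, div_zpow, zpow_add₀ ha]
  have := zpow_ne_zero (intTriangle j) ha
  field_simp

theorem ramanujanThetaTerm_zero_right (a : ℂ) {j : ℤ} (hj : j ∉ ({0, 1} : Finset ℤ)) :
    ramanujanThetaTerm a 0 j = 0 := by
  have h := two_mul_intTriangle j
  have hne : intTriangle j ≠ 0 := by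
    intro h0
    rw [h0, mul_zero, eq_comm, mul_eq_zero] at h
    simp only [Finset.mem_insert, Finset.mem_singleton] at hj
    lia
  rw [ramanujanThetaTerm, ← intTriangle, zero_zpow _ hne, mul_zero]

theorem hasSum_ramanujanThetaTerm_zero_right (a : ℂ) :
    HasSum (ramanujanThetaTerm a 0) (1 + a) := by
  have h : HasSum (ramanujanThetaTerm a 0) _ :=
    hasSum_sum_of_ne_finset_zero (s := {0, 1}) fun j => ramanujanThetaTerm_zero_right a
  simpa [ramanujanThetaTerm] using h

theorem mainTheorem1 (a x : ℂ) (ha : a ≠ 0) (hx : ‖x‖ < 1) :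
    Summable (ramanujanThetaTerm a (x ^ 6 / a)) ∧
    Summable (ramanujanThetaTerm (-x ^ 2) (-(-x ^ 2) ^ 2)) ∧
    ramanujanF (-x ^ 2) ≠ 0 ∧
    HasSum
      (fun n : ℕ =>
        x ^ (2 * n * (n + 1)) * qFactorial (-a) (x ^ 2) (n + 1) *
            qFactorial (-x ^ 2 / a) (x ^ 2) n /
          qFactorial (x ^ 2) (x ^ 2) (2 * n + 1))
      (ramanujanTheta a (x ^ 6 / a) / ramanujanF (-x ^ 2)) := by
  -- At x = 0 the exponent laws for integer powers fail, but only j = 0, 1 contribute to the theta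
  -- series and n = 0 to the left side.
  rcases eq_or_ne x 0 with rfl | hx0
  · have h1 := hasSum_ramanujanThetaTerm_zero_right a
    have h2 := hasSum_ramanujanThetaTerm_zero_right 0
    refine ⟨by simpa using h1.summable, by simpa using h2.summable, ?_, ?_⟩
    · simp [ramanujanF, ramanujanTheta, h2.tsum_eq]
    · have h := hasSum_single (L := .unconditional ℕ) (f := fun n : ℕ =>
        (0 : ℂ) ^ (2 * n * (n + 1)) * qFactorial (-a) (0 ^ 2) (n + 1) *
            qFactorial (-0 ^ 2 / a) (0 ^ 2) n / qFactorial (0 ^ 2) (0 ^ 2) (2 * n + 1)) 0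
        (fun n hn => by simp [hn])
      simpa [ramanujanF, ramanujanTheta, h1.tsum_eq, h2.tsum_eq, qFactorial] using h
  · have hq0 : x ^ 2 ≠ 0 := pow_ne_zero 2 hx0
    have hq : ‖x ^ 2‖ < 1 := by
      rw [norm_pow]; exact pow_lt_one₀ (norm_nonneg _) hx (by norm_num)
    have hQ : ‖(x ^ 2) ^ 3‖ < 1 := by
      rw [norm_pow]; exact pow_lt_one₀ (norm_nonneg _) hq (by norm_num)
    have hQ0 := pow_ne_zero 3 hq0
    have hA : ramanujanThetaTerm a (x ^ 6 / a) = fun j => a ^ j * ((x ^ 2) ^ 3) ^ intTriangle j :=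
      funext fun j => ramanujanThetaTerm_eq ha (by ring) j
    have hB : ramanujanThetaTerm (-x ^ 2) (-(-x ^ 2) ^ 2) =
        fun j => (-x ^ 2) ^ j * ((x ^ 2) ^ 3) ^ intTriangle j :=
      funext fun j => ramanujanThetaTerm_eq (neg_ne_zero.mpr hq0) (by field_simp) j
    have hF : ramanujanF (-x ^ 2) = qFactorialInf (x ^ 2) := by
      rw [ramanujanF, ramanujanTheta, hB, tsum_pentagonal hq0 hq]
    refine ⟨?_, ?_, ?_, ?_⟩
    · rw [hA]
      exact (summable_norm_zpow_mul_zpow_intTriangle hQ0 hQ ha).of_norm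
    · rw [hB]
      exact (summable_norm_zpow_mul_zpow_intTriangle hQ0 hQ (neg_ne_zero.mpr hq0)).of_norm
    · rw [hF]
      exact qFactorialInf_ne_zero hq
    · rw [hF, ramanujanTheta, hA, div_eq_mul_inv]
      convert! hasSum_qSeries hq0 hq ha using 1
      funext n
      rw [← pow_mul]
      ring_nf
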